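/- **Theorem.** Let $\varrho$ be the sister silver mean substitution $a\mapsto bba$, $b\mapsto ab$ on the alphabet $\{a,b\}$, and let $\lambda=1+\sqrt2$. Iterating $\varrho$ on the seed $a|a$ (where $|$ marks the origin) gives two bi-infinite words $\omega=\lim_n \varrho^{2n}(a)|\varrho^{2n}(a)$ and $\omega'=\lim_n \varrho^{2n+1}(a)|\varrho^{2n+1}(a)$ with $\varrho(\omega)=\omega'$ and $\varrho(\omega')=\omega$. Turn $\omega$ (or $\omega'$) into a tiling of $\mathbb R$ by replacing each letter $a$ by an interval of length $\sqrt2$ and each letter $b$ by an interval of length $1$, with a tile boundary at the origin where the marker is. Let $\varLambda_\alpha\subset\mathbb Z[\sqrt2]$ be the set of left endpoints of the tiles of type $\alpha\in\{a,b\}$ and $\varLambda=\varLambda_a\cup\varLambda_b$. For $\alpha,\beta\in\{a,b\}$ and $z\in\mathbb Z[\sqrt2]$ put $$\nu_{\alpha\beta}(z)=\lim_{r\to\infty}\frac{\operatorname{card}\{x\in\varLambda_\alpha : |x|<r,\ x+z\in\varLambda_\beta\}}{\operatorname{card}\{x\in\varLambda : |x|<r\}} .$$ These limits exist, they are the same for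 $\omega$ and for $\omega'$, and for all $z\in\mathbb Z[\sqrt2]$ they satisfy the exact renormalisation relations $$\begin{aligned} \lambda\nu_{aa}(z)&=\nu_{aa}\bigl(\tfrac{z}{\lambda}\bigr)+\nu_{ab}\bigl(\tfrac{z+2}{\lambda}\bigr)+\nu_{ba}\bigl(\tfrac{z-2}{\lambda}\bigr)+\nu_{bb}\bigl(\tfrac{z}{\lambda}\bigr),\\ \lambda\nu_{ab}(z)&=\nu_{aa}\bigl(\tfrac{z+2}{\lambda}\bigr)+\nu_{aa}\bigl(\tfrac{z+1}{\lambda}\bigr)+\nu_{ab}\bigl(\tfrac{z+3-\lambda}{\lambda}\bigr)+\nu_{ba}\bigl(\tfrac{z}{\lambda}\bigr)+\nu_{ba}\bigl(\tfrac{z-1}{\lambda}\bigr)+\nu_{bb}\bigl(\tfrac{z+1-\lambda}{\lambda}\bigr),\\ \lambda\nu_{ba}(z)&=\nu_{aa}\bigl(\tfrac{z-2}{\lambda}\bigr)+\nu_{aa}\bigl(\tfrac{z-1}{\lambda}\bigr)+\nu_{ab}\bigl(\tfrac{z+1}{\lambda}\bigr)+\nu_{ab}\bigl(\tfrac{z}{\lambda}\bigr)+\nu_{ba}\bigl(\tfrac{z+\lambda-3}{\lambda}\bigr)+\nu_{bb}\bigl(\tfrac{z+\lambda-1}{\lambda}\bigr),\\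 \lambda\nu_{bb}(z)&=2\nu_{aa}\bigl(\tfrac{z}{\lambda}\bigr)+\nu_{aa}\bigl(\tfrac{z+1}{\lambda}\bigr)+\nu_{aa}\bigl(\tfrac{z-1}{\lambda}\bigr)+\nu_{ab}\bigl(\tfrac{z+1-\lambda}{\lambda}\bigr)+\nu_{ab}\bigl(\tfrac{z+2-\lambda}{\lambda}\bigr)\\ &\quad+\nu_{ba}\bigl(\tfrac{z+\lambda-2}{\lambda}\bigr)+\nu_{ba}\bigl(\tfrac{z+\lambda-1}{\lambda}\bigr)+\nu_{bb}\bigl(\tfrac{z}{\lambda}\bigr). \end{aligned}$$ Moreover, for either tiling, $\nu_{\alpha\beta}(z)=0$ for every $z\in\mathbb Z[\sqrt2]$ with $z\notin\varLambda_\beta-\varLambda_\alpha$. -/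

import Mathlib

open Filter Topology
open scoped Pointwise

namespace SisterSilver

/-- The binary alphabet. -/
inductive Letter where
  | a : Letter
  | b : Letter

open Letter

/-- The inflation factor `λ = 1 + √2`. -/
noncomputable def infl : ℝ := 1 + √2

/-- The ring `ℤ[√2]` as a subring of the reals. -/
def ringSqrtTwo : Subalgebra ℤ ℝ := Algebra.adjoin ℤ {√2}

/-- The substitution on letters: `a ↦ bba`, `b ↦ ab`. -/
def subst : Letter → List Letter
  | a => [b, b, a]
  | b => [a, b]

/-- The substitution on finite words (concatenation of the images of the letters). -/
def substWord (u : List Letter) : List Letter := u.flatMap subst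

/-- The `n`-fold image of the letter `a` under the substitution. -/
def level (n : ℕ) : List Letter := substWord^[n] [a]

/-- The two bi-infinite words of the 2-cycle obtained from the seed `a|a`: for `p = 0` this is the
limit of the two-sided words `level (2n) | level (2n)`, for `p = 1` the limit of
`level (2n+1) | level (2n+1)`, the bar standing between the positions `-1` and `0`.
(`level n` has more than `n` letters, so the default value of `getD` is never used; that these
words are the limits is proved in `bi_word_right` and `bi_word_left` below.) -/
def biWord (p : Fin 2) : ℤ → Letter
  | Int.ofNat k => (level (2 * k + p)).getD k a
  | Int.negSucc k => (level (2 * k + p)).reverse.getD k a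

/-- The tile lengths: `√2` for `a` and `1` for `b`. -/
noncomputable def tileLength : Letter → ℝ
  | a => √2
  | b => 1

/-- The left endpoint of the `n`-th tile when the letters of the bi-infinite word `w` are replaced
by tiles, the tile number `0` starting at the origin. (At most one of the sums is non-empty.) -/
noncomputable def leftEnd (w : ℤ → Letter) (n : ℤ) : ℝ :=
  ∑ k ∈ Finset.Ico 0 n, tileLength (w k) - ∑ k ∈ Finset.Ico n 0, tileLength (w k)

/-- The control points (left endpoints) of the tiles of type `α`. -/
def controlPoints (w : ℤ → Letter) (α : Letter) : Set ℝ :=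
  {x | ∃ n : ℤ, w n = α ∧ leftEnd w n = x}

/-- All control points. -/
def allControlPoints (w : ℤ → Letter) : Set ℝ := ⋃ α : Letter, controlPoints w α

/-- The relative frequency, within the ball `B_r(0)`, of control points `x` of type `α` such that
`x + z` is a control point of type `β`. -/
noncomputable def relFreq (w : ℤ → Letter) (α β : Letter) (z r : ℝ) : ℝ :=
  (({x | x ∈ controlPoints w α ∩ Metric.ball 0 r ∧ x + z ∈ controlPoints w β}).ncard : ℝ) /
    ((allControlPoints w ∩ Metric.ball 0 r).ncard : ℝ)

/-- The pair correlation function `ν_{αβ}`. -/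
noncomputable def pairCorr (w : ℤ → Letter) (α β : Letter) (z : ℝ) : ℝ :=
  limUnder atTop (relFreq w α β z)

/-- The exact renormalisation relations at the point `z`, for four functions `ν α β`. -/
def RenormRelationsAt (ν : Letter → Letter → ℝ → ℝ) (z : ℝ) : Prop :=
  infl * ν a a z =
    ν a a (z / infl) + ν a b ((z + 2) / infl) + ν b a ((z - 2) / infl) + ν b b (z / infl) ∧
  infl * ν a b z =
    ν a a ((z + 2) / infl) + ν a a ((z + 1) / infl) + ν a b ((z + 3 - infl) / infl)
      + ν b a (z / infl) + ν b a ((z - 1) / infl) + ν b b ((z + 1 - infl) / infl) ∧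
  infl * ν b a z =
    ν a a ((z - 2) / infl) + ν a a ((z - 1) / infl) + ν a b ((z + 1) / infl)
      + ν a b (z / infl) + ν b a ((z + infl - 3) / infl) + ν b b ((z + infl - 1) / infl) ∧
  infl * ν b b z =
    2 * ν a a (z / infl) + ν a a ((z + 1) / infl) + ν a a ((z - 1) / infl)
      + ν a b ((z + 1 - infl) / infl) + ν a b ((z + 2 - infl) / infl)
      + ν b a ((z + infl - 2) / infl) + ν b a ((z + infl - 1) / infl) + ν b b (z / infl)

theorem length_lt_level (n : ℕ) : n < (level n).length := by
  have key : ∀ u : List Letter, u ≠ [] → u.length < (substWord u).length := by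
    intro u hu
    induction u with
    | nil => exact absurd rfl hu
    | cons c u ih =>
      have hc : 2 ≤ (subst c).length := by cases c <;> simp [subst]
      by_cases h : u = []
      · subst h
        simp only [substWord, List.flatMap_cons, List.flatMap_nil, List.append_nil,
          List.length_cons, List.length_nil]
        omega
      · have := ih h
        simp only [substWord, List.flatMap_cons, List.length_append, List.length_cons] at this ⊢
        omega
  induction n with
  | zero => simp [level]
  | succ n ih =>
    have h : level (n + 1) = substWord (level n) := by
      simp only [level, Function.iterate_succ_apply']
    have := key (level n) (by intro h0; simp [h0] at ih)
    rw [h]; omega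

theorem level_prefix {m n : ℕ} (h : m ≤ n) (p : ℕ) : level (2 * m + p) <+: level (2 * n + p) := by
  have step : ∀ k, level k <+: level (k + 2) := by
    intro k
    induction k with
    | zero => exact ⟨[b, a, b, b, b, a], rfl⟩
    | succ k ih =>
      obtain ⟨t, ht⟩ := ih
      refine ⟨substWord t, ?_⟩
      have h1 : level (k + 1) = substWord (level k) := by
        simp only [level, Function.iterate_succ_apply']
      have h2 : level (k + 1 + 2) = substWord (level (k + 2)) := by
        rw [show k + 1 + 2 = (k + 2) + 1 by ring]
        simp only [level, Function.iterate_succ_apply']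
      rw [h1, h2, ← ht]
      simp [substWord]
  induction n, h using Nat.le_induction with
  | base => exact List.prefix_refl _
  | succ n _ ih =>
    refine ih.trans ?_
    have := step (2 * n + p)
    rwa [show 2 * n + p + 2 = 2 * (n + 1) + p by ring] at this

theorem level_suffix {m n : ℕ} (h : m ≤ n) : level m <:+ level n := by
  have step : ∀ k, level k <:+ level (k + 1) := by
    intro k
    induction k with
    | zero => exact ⟨[b, b], rfl⟩
    | succ k ih =>
      obtain ⟨t, ht⟩ := ih
      refine ⟨substWord t, ?_⟩
      have hs : ∀ j, level (j + 1) = substWord (level j) := by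
        intro j
        simp only [level, Function.iterate_succ_apply']
      calc substWord t ++ level (k + 1) = substWord t ++ substWord (level k) := by rw [hs k]
        _ = substWord (t ++ level k) := by simp [substWord]
        _ = level (k + 1 + 1) := by rw [ht, ← hs (k + 1)]
  induction n, h using Nat.le_induction with
  | base => exact List.suffix_refl _
  | succ n _ ih => exact ih.trans (step n)

/-- The right half of `biWord p` begins with `level (2n+p)`, for every `n`. -/
theorem bi_word_right (p : Fin 2) (n k : ℕ) (hk : k < (level (2 * n + p)).length) :
    biWord p (k : ℤ) = (level (2 * n + p))[k] := by
  have hl : k < (level (2 * k + p)).length :=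
    lt_of_le_of_lt (by omega) (length_lt_level (2 * k + p))
  change (level (2 * k + p)).getD k a = _
  rw [List.getD_eq_getElem _ _ hl]
  rcases le_total n k with h | h
  · exact ((level_prefix h p).getElem hk).symm
  · exact (level_prefix h p).getElem hl

/-- The left half of `biWord p` ends with `level (2n+p)`, for every `n`. -/
theorem bi_word_left (p : Fin 2) (n k : ℕ) (hk : k < (level (2 * n + p)).length) :
    biWord p (-(k : ℤ) - 1) = (level (2 * n + p)).reverse[k]'(by simpa using hk) := by
  have hl : k < (level (2 * k + p)).length :=
    lt_of_le_of_lt (by omega) (length_lt_level (2 * k + p))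
  have hk' : -(k : ℤ) - 1 = Int.negSucc k := by omega
  rw [hk']
  change (level (2 * k + p)).reverse.getD k a = _
  rw [List.getD_eq_getElem _ _ (by simpa using hl)]
  rcases le_total n k with h | h
  · have hs : level (2 * n + p) <:+ level (2 * k + p) := level_suffix (by omega)
    exact ((List.reverse_prefix.mpr hs).getElem (by simpa using hk)).symm
  · have hs : level (2 * k + p) <:+ level (2 * n + p) := level_suffix (by omega)
    exact (List.reverse_prefix.mpr hs).getElem (by simpa using hl)

end SisterSilver

namespace SisterSilver

open Letter

/-! For finite words the relations hold exactly. Inflating a patch by `infl` sends a tile at x to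
tiles at `infl` * x + s, with finitely many offsets s determined by the letters. A pair at distance
z in the image with offsets s, t therefore comes from a unique pair at distance (z + s - t) /
`infl`. This expresses `pairCount` of `substWord u` as a sum of values of `pairCount` at `u` (the
lemmas `pairCount_substWord_aa` to `pairCount_substWord_bb`). Dividing by length, which grows by the
factor `infl`, turns this into the renormalisation relations, provided that pair densities exist.

Existence rests on near additivity: concatenation changes `pairCount` only by pairs straddling the
seam, a number bounded in terms of z (`pairCount_append`). On supertiles the counts thus follow the
linear recursion of the substitution matrix up to bounded errors. Its second eigenvalue 1 - √2 is
contracting, so the counts are κ times the length plus a bounded error, with the same κ for both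
types of supertile (`exists_pairCount_superWord`). Cutting long patches into supertiles of a fixed
level carries this over to prefixes and suffixes of `level n` (`exists_pairCount_uniform`), hence to
centred balls in either tiling. Since κ depends only on supertiles, both tilings have the same
limits, namely κ divided by the density of all control points. -/

/-! ### Control points of finite words -/

/-- The length of the patch of tiles given by a finite word. -/
noncomputable def wordLength (u : List Letter) : ℝ := (u.map tileLength).sum

open Classical in
/-- The left endpoints of the tiles of type `α` in the patch of a finite word that starts at `0`. -/
noncomputable def pts (α : Letter) : List Letter → Multiset ℝ
  | [] => 0
  | c :: u => (if c = α then {0} else 0) + (pts α u).map (tileLength c + ·)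

/-- The number of pairs `(x, x + z)` with `x` in `S` and `x + z` in `T`. -/
noncomputable def matchCount (S T : Multiset ℝ) (z : ℝ) : ℕ :=
  (S.map fun x => T.count (x + z)).sum

/-- The number of pairs of a tile of type `α` and a tile of type `β` at distance `z`. -/
noncomputable def pairCount (α β : Letter) (z : ℝ) (u : List Letter) : ℕ :=
  matchCount (pts α u) (pts β u) z

theorem one_le_tileLength (c : Letter) : 1 ≤ tileLength c := by
  cases c
  · exact Real.one_le_sqrt.mpr (by norm_num)
  · exact le_rfl

theorem tileLength_le (c : Letter) : tileLength c ≤ √2 := by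
  cases c
  · exact le_rfl
  · exact Real.one_le_sqrt.mpr (by norm_num)

theorem one_lt_infl : 1 < infl := by
  have : 0 < √2 := by positivity
  unfold infl; linarith

theorem infl_pos : 0 < infl := zero_lt_one.trans one_lt_infl

theorem infl_mul_sqrt : infl * √2 = 2 + √2 := by
  have : √2 * √2 = 2 := Real.mul_self_sqrt (by norm_num)
  unfold infl; linarith

@[simp] theorem wordLength_nil : wordLength [] = 0 := rfl

@[simp] theorem wordLength_cons (c : Letter) (u : List Letter) :
    wordLength (c :: u) = tileLength c + wordLength u := rfl

@[simp] theorem wordLength_append (u v : List Letter) :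
    wordLength (u ++ v) = wordLength u + wordLength v := by
  simp [wordLength]

@[simp] theorem wordLength_reverse (u : List Letter) :
    wordLength u.reverse = wordLength u := by
  simp [wordLength]

theorem length_le_wordLength (u : List Letter) : (u.length : ℝ) ≤ wordLength u := by
  induction u with
  | nil => simp
  | cons c u ih =>
    have := one_le_tileLength c
    push_cast [List.length_cons, wordLength_cons]; linarith

theorem wordLength_le_length (u : List Letter) : wordLength u ≤ √2 * u.length := by
  induction u with
  | nil => simp
  | cons c u ih =>
    have := tileLength_le c
    push_cast [List.length_cons, wordLength_cons]; linarith

theorem wordLength_nonneg (u : List Letter) : 0 ≤ wordLength u :=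
  (Nat.cast_nonneg _).trans (length_le_wordLength u)

@[simp] theorem pts_nil (α : Letter) : pts α [] = 0 := rfl

open Classical in
theorem pts_cons (α c : Letter) (u : List Letter) :
    pts α (c :: u) = (if c = α then {0} else 0) + (pts α u).map (tileLength c + ·) := rfl

theorem pts_append (α : Letter) (u v : List Letter) :
    pts α (u ++ v) = pts α u + (pts α v).map (wordLength u + ·) := by
  induction u with
  | nil => simp
  | cons c u ih =>
    simp [pts_cons, ih, add_assoc, Multiset.map_map]

theorem mem_pts_bounds {α : Letter} {u : List Letter} {x : ℝ} (hx : x ∈ pts α u) :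
    0 ≤ x ∧ x < wordLength u := by
  induction u generalizing x with
  | nil => simp at hx
  | cons c u ih =>
    have hc := one_le_tileLength c
    have hu := wordLength_nonneg u
    rw [pts_cons, Multiset.mem_add, Multiset.mem_map] at hx
    rw [wordLength_cons]
    rcases hx with hx | ⟨y, hy, rfl⟩
    · have : x = 0 := by
        split_ifs at hx <;> simp_all
      constructor <;> linarith
    · obtain ⟨h0, h1⟩ := ih hy
      constructor <;> linarith

/-- Multisets make sums and affine images additive without disjointness checks; distinctness is what
turns `matchCount` back into a cardinality. -/
theorem pts_nodup (α : Letter) (u : List Letter) : (pts α u).Nodup := by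
  induction u with
  | nil => simp
  | cons c u ih =>
    rw [pts_cons, Multiset.nodup_add]
    refine ⟨by split_ifs <;> simp, ih.map (add_right_injective _), ?_⟩
    rw [Multiset.disjoint_left]
    intro x hx hx'
    obtain ⟨y, hy, rfl⟩ := Multiset.mem_map.mp hx'
    have h0 := (mem_pts_bounds hy).1
    have hc := one_le_tileLength c
    split_ifs at hx
    · rw [Multiset.mem_singleton] at hx; linarith
    · simp at hx

theorem card_pts_add_card_pts (u : List Letter) :
    (pts a u).card + (pts b u).card = u.length := by
  induction u with
  | nil => simp
  | cons c u ih => cases c <;> simp [pts_cons] <;> omega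

theorem card_pts_le (α : Letter) (u : List Letter) : (pts α u).card ≤ u.length := by
  have := card_pts_add_card_pts u
  cases α <;> omega

open Classical in
/-- There are at most `s` control points at distance at most `s` from the right end of a patch. -/
theorem card_pts_filter_right (α : Letter) (u : List Letter) (s : ℝ) :
    (((pts α u).filter fun x => wordLength u - s ≤ x).card : ℝ) ≤ max 0 s := by
  induction u with
  | nil => simp
  | cons c u ih =>
    have hc := one_le_tileLength c
    -- If the whole patch fits into the range, its number of tiles is at most its length. Otherwise
    -- the first tile starts outside the range and can be dropped.
    by_cases hs : wordLength (c :: u) ≤ s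
    · calc _ ≤ ((pts α (c :: u)).card : ℝ) :=
          Nat.cast_le.mpr (Multiset.card_le_card (Multiset.filter_le _ _))
        _ ≤ ((c :: u).length : ℝ) := by exact_mod_cast card_pts_le _ _
        _ ≤ s := (length_le_wordLength _).trans hs
        _ ≤ max 0 s := le_max_right _ _
    · have h1 : (if c = α then ({0} : Multiset ℝ) else 0).filter
          (fun x => wordLength (c :: u) - s ≤ x) = 0 := by
        rw [Multiset.filter_eq_nil]
        intro x hx
        split_ifs at hx
        · rw [Multiset.mem_singleton] at hx
          subst hx; linarith
        · simp at hx
      rw [pts_cons, Multiset.filter_add, h1, zero_add, Multiset.filter_map, Multiset.card_map]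
      convert ih using 4
      simp only [Function.comp_apply, wordLength_cons]
      constructor <;> intro h <;> linarith

open Classical in
/-- There are at most `t + 1` control points at distance less than `t` from the left end of a
patch. -/
theorem card_pts_filter_left (α : Letter) (u : List Letter) (t : ℝ) :
    (((pts α u).filter fun x => x < t).card : ℝ) ≤ max 0 (t + 1) := by
  induction u generalizing t with
  | nil => simp
  | cons c u ih =>
    have hc := one_le_tileLength c
    by_cases ht : t ≤ 0
    · have : (pts α (c :: u)).filter (fun x => x < t) = 0 := by
        rw [Multiset.filter_eq_nil]
        intro x hx
        have := (mem_pts_bounds hx).1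
        linarith
      rw [this]; simp
    · push Not at ht
      rw [pts_cons, Multiset.filter_add, Multiset.card_add, Multiset.filter_map, Multiset.card_map]
      have h1 : (((if c = α then ({0} : Multiset ℝ) else 0).filter
          (fun x => x < t)).card : ℝ) ≤ 1 := by
        have : ((if c = α then ({0} : Multiset ℝ) else 0).filter (fun x => x < t)).card ≤ 1 :=
          (Multiset.card_le_card (Multiset.filter_le _ _)).trans (by split_ifs <;> simp)
        exact_mod_cast this
      have h2 : ((fun x => x < t) ∘ fun x => tileLength c + x) = fun x => x < t - tileLength c := by
        funext x
        simp only [Function.comp_apply, eq_iff_iff]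
        constructor <;> intro h <;> linarith
      have h3 := ih (t - tileLength c)
      -- The first tile contributes at most one point, and its length, at least 1, pays for that
      -- point.
      have h4 : max 0 (t - tileLength c + 1) ≤ t := max_le ht.le (by linarith)
      have h5 := le_max_right 0 (t + 1)
      simp only [h2]
      push_cast
      linarith

/-! ### Counting pairs -/

theorem matchCount_add_left (S S' T : Multiset ℝ) (z : ℝ) :
    matchCount (S + S') T z = matchCount S T z + matchCount S' T z := by
  simp [matchCount]

theorem matchCount_add_right (S T T' : Multiset ℝ) (z : ℝ) :
    matchCount S (T + T') z = matchCount S T z + matchCount S T' z := by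
  simp [matchCount]

/-- The equation l * x + s + z = l * y + t means y = x + (z + s - t) / l. All arguments in the
renormalisation relations arise in this way. -/
theorem matchCount_affine {l : ℝ} (hl : l ≠ 0) (s t : ℝ) (S T : Multiset ℝ) (z : ℝ) :
    matchCount (S.map (l * · + s)) (T.map (l * · + t)) z = matchCount S T ((z + s - t) / l) := by
  have hinj : Function.Injective (fun x : ℝ => l * x + t) := fun x y h => by
    simpa [hl] using h
  simp only [matchCount, Multiset.map_map, Function.comp_def]
  congr 2
  funext x
  rw [← Multiset.count_map_eq_count' _ T hinj]
  congr 1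
  field_simp
  ring

theorem matchCount_shift (s : ℝ) (S T : Multiset ℝ) (z : ℝ) :
    matchCount (S.map (s + ·)) (T.map (s + ·)) z = matchCount S T z := by
  simpa [add_comm] using matchCount_affine one_ne_zero s s S T z

open Classical in
theorem matchCount_eq_card_filter {S T : Multiset ℝ} {z : ℝ} (hT : T.Nodup) :
    matchCount S T z = (S.filter fun x => x + z ∈ T).card := by
  induction S using Multiset.induction_on with
  | empty => simp [matchCount]
  | cons x S ih =>
    have : matchCount (x ::ₘ S) T z = T.count (x + z) + matchCount S T z := by
      simp [matchCount]
    rw [this, ih, Multiset.filter_cons, Multiset.card_add]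
    by_cases hx : x + z ∈ T
    · simp [hx, Multiset.count_eq_one_of_mem hT hx]
    · simp [hx]

open Classical in
theorem matchCount_le {S T : Multiset ℝ} {z : ℝ} (hT : T.Nodup) (P : ℝ → Prop)
    (h : ∀ x ∈ S, x + z ∈ T → P x) : matchCount S T z ≤ (S.filter P).card := by
  rw [matchCount_eq_card_filter hT]
  refine Multiset.card_le_card ?_
  rw [Multiset.le_filter]
  refine ⟨Multiset.filter_le _ _, fun x hx => ?_⟩
  obtain ⟨h1, h2⟩ := Multiset.mem_filter.mp hx
  exact h x h1 h2

theorem pairCount_le_length (α β : Letter) (z : ℝ) (u : List Letter) :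
    pairCount α β z u ≤ u.length := by
  classical
  rw [pairCount, matchCount_eq_card_filter (pts_nodup β u)]
  exact (Multiset.card_le_card (Multiset.filter_le _ _)).trans (card_pts_le α u)

theorem pairCount_self_zero (α : Letter) (u : List Letter) :
    pairCount α α 0 u = (pts α u).card := by
  classical
  rw [pairCount, matchCount_eq_card_filter (pts_nodup α u), Multiset.filter_eq_self.mpr]
  simp

/-- Only pairs across the seam are missed by the two separate counts. Those from `u` to `v` start
within z of the right end of `u`; those from `v` to `u` start less than -z after the left end of
`v`. -/
theorem pairCount_append (α β : Letter) (z : ℝ) (u v : List Letter) :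
    |(pairCount α β z (u ++ v) : ℝ) - (pairCount α β z u + pairCount α β z v)| ≤ 2 * |z| + 1 := by
  classical
  have h1 : (matchCount (pts α u) ((pts β v).map (wordLength u + ·)) z : ℝ) ≤ |z| := by
    have h := matchCount_le (S := pts α u) (z := z)
      ((pts_nodup β v).map (add_right_injective (wordLength u)))
      (fun x => wordLength u - z ≤ x) (by
        intro x _ hx
        obtain ⟨y, hy, hxy⟩ := Multiset.mem_map.mp hx
        have := (mem_pts_bounds hy).1
        linarith)
    calc _ ≤ (((pts α u).filter fun x => wordLength u - z ≤ x).card : ℝ) := by exact_mod_cast h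
      _ ≤ max 0 z := card_pts_filter_right _ _ _
      _ ≤ |z| := max_le (abs_nonneg _) (le_abs_self _)
  have h2 : (matchCount ((pts α v).map (wordLength u + ·)) (pts β u) z : ℝ) ≤ |z| + 1 := by
    have h := matchCount_le (S := (pts α v).map (wordLength u + ·)) (z := z) (pts_nodup β u)
      (fun x => x < wordLength u - z) (by
        intro x _ hx
        have := (mem_pts_bounds hx).2
        linarith)
    rw [Multiset.filter_map, Multiset.card_map] at h
    have h3 : ((fun x => x < wordLength u - z) ∘ fun x => wordLength u + x) = fun x => x < -z := by
      funext x
      simp only [Function.comp_apply, eq_iff_iff]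
      constructor <;> intro h <;> linarith
    simp only [h3] at h
    calc _ ≤ (((pts α v).filter fun x => x < -z).card : ℝ) := by exact_mod_cast h
      _ ≤ max 0 (-z + 1) := card_pts_filter_left _ _ _
      _ ≤ |z| + 1 := max_le (by positivity) (by linarith [neg_abs_le z])
  have h3 : pairCount α β z (u ++ v) = pairCount α β z u + pairCount α β z v +
      (matchCount (pts α u) ((pts β v).map (wordLength u + ·)) z +
        matchCount ((pts α v).map (wordLength u + ·)) (pts β u) z) := by
    simp only [pairCount, pts_append, matchCount_add_left, matchCount_add_right, matchCount_shift]
    ring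
  rw [h3]
  push_cast
  rw [add_sub_cancel_left, abs_of_nonneg (by positivity)]
  linarith

/-! ### The substitution on finite words -/

theorem substWord_cons (c : Letter) (u : List Letter) :
    substWord (c :: u) = subst c ++ substWord u := by
  simp [substWord]

theorem wordLength_subst (c : Letter) : wordLength (subst c) = infl * tileLength c := by
  cases c
  · simp only [subst, wordLength_cons, wordLength_nil, tileLength, infl_mul_sqrt]; ring
  · simp only [subst, wordLength_cons, wordLength_nil, tileLength, infl]; ring

theorem wordLength_substWord (u : List Letter) :
    wordLength (substWord u) = infl * wordLength u := by
  induction u with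
  | nil => simp [substWord]
  | cons c u ih => rw [substWord_cons, wordLength_append, ih, wordLength_subst]; simp [mul_add]

/-- The letter `a` starts at 2 in the patch of bba and at 0 in that of ab. -/
theorem pts_a_substWord (u : List Letter) : pts a (substWord u) =
    (pts a u).map (infl * · + 2) + (pts b u).map (infl * · + 0) := by
  induction u with
  | nil => simp [substWord]
  | cons c u ih =>
    rw [substWord_cons, pts_append, ih, wordLength_subst]
    cases c
    · simp [pts_cons, subst, tileLength, Multiset.map_map, mul_add, add_assoc,
        one_add_one_eq_two]
    · simp [pts_cons, subst, tileLength, Multiset.map_map, mul_add, add_assoc]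

/-- The letter `b` starts at 0 and 1 in the patch of bba, and at √2 = `infl` - 1 in that of ab. -/
theorem pts_b_substWord (u : List Letter) : pts b (substWord u) =
    (pts a u).map (infl * · + 0) + (pts a u).map (infl * · + 1) +
      (pts b u).map (infl * · + (infl - 1)) := by
  induction u with
  | nil => simp [substWord]
  | cons c u ih =>
    rw [substWord_cons, pts_append, ih, wordLength_subst]
    cases c
    · simp only [pts_cons, subst, tileLength, Multiset.map_map, mul_add, Multiset.map_add,
        Function.comp_def, add_assoc]
      simp [add_left_comm]
    · simp [pts_cons, subst, tileLength, Multiset.map_map, mul_add, add_assoc, infl]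

theorem pairCount_substWord_aa (z : ℝ) (u : List Letter) : pairCount a a z (substWord u) =
    pairCount a a (z / infl) u + pairCount a b ((z + 2) / infl) u +
      pairCount b a ((z - 2) / infl) u + pairCount b b (z / infl) u := by
  simp only [pairCount, pts_a_substWord, matchCount_add_left, matchCount_add_right,
    matchCount_affine infl_pos.ne']
  ring_nf

theorem pairCount_substWord_ab (z : ℝ) (u : List Letter) : pairCount a b z (substWord u) =
    pairCount a a ((z + 2) / infl) u + pairCount a a ((z + 1) / infl) u
      + pairCount a b ((z + 3 - infl) / infl) u
      + pairCount b a (z / infl) u + pairCount b a ((z - 1) / infl) u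
      + pairCount b b ((z + 1 - infl) / infl) u := by
  simp only [pairCount, pts_a_substWord, pts_b_substWord, matchCount_add_left,
    matchCount_add_right, matchCount_affine infl_pos.ne']
  ring_nf

theorem pairCount_substWord_ba (z : ℝ) (u : List Letter) : pairCount b a z (substWord u) =
    pairCount a a ((z - 2) / infl) u + pairCount a a ((z - 1) / infl) u
      + pairCount a b ((z + 1) / infl) u
      + pairCount a b (z / infl) u + pairCount b a ((z + infl - 3) / infl) u
      + pairCount b b ((z + infl - 1) / infl) u := by
  simp only [pairCount, pts_a_substWord, pts_b_substWord, matchCount_add_left,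
    matchCount_add_right, matchCount_affine infl_pos.ne']
  ring_nf

theorem pairCount_substWord_bb (z : ℝ) (u : List Letter) : pairCount b b z (substWord u) =
    2 * pairCount a a (z / infl) u + pairCount a a ((z + 1) / infl) u
      + pairCount a a ((z - 1) / infl) u
      + pairCount a b ((z + 1 - infl) / infl) u + pairCount a b ((z + 2 - infl) / infl) u
      + pairCount b a ((z + infl - 2) / infl) u + pairCount b a ((z + infl - 1) / infl) u
      + pairCount b b (z / infl) u := by
  simp only [pairCount, pts_b_substWord, matchCount_add_left,
    matchCount_add_right, matchCount_affine infl_pos.ne']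
  ring_nf

/-! ### Supertiles and the growth of their pair counts -/

/-- The `n`-fold image of a letter under the substitution. -/
def superWord (n : ℕ) (c : Letter) : List Letter := substWord^[n] [c]

theorem substWord_iterate (n : ℕ) (u : List Letter) :
    substWord^[n] u = u.flatMap (superWord n) := by
  induction n generalizing u with
  | zero =>
    have h : superWord 0 = fun c => [c] := rfl
    simp [h]
  | succ n ih =>
    have h : superWord (n + 1) = fun c => (subst c).flatMap (superWord n) := by
      funext c
      rw [superWord, Function.iterate_succ_apply, ih]
      simp [substWord]
    rw [Function.iterate_succ_apply, ih, h, substWord, List.flatMap_assoc]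

theorem superWord_succ_a (n : ℕ) :
    superWord (n + 1) a = superWord n b ++ (superWord n b ++ superWord n a) := by
  rw [superWord, Function.iterate_succ_apply, substWord_iterate]
  simp [substWord, subst]

theorem superWord_succ_b (n : ℕ) :
    superWord (n + 1) b = superWord n a ++ superWord n b := by
  rw [superWord, Function.iterate_succ_apply, substWord_iterate]
  simp [substWord, subst]

theorem wordLength_superWord (n : ℕ) (c : Letter) :
    wordLength (superWord n c) = infl ^ n * tileLength c := by
  induction n with
  | zero => simp [superWord]
  | succ n ih =>
    rw [superWord, Function.iterate_succ_apply', ← superWord, wordLength_substWord, ih]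
    ring

/-- A real sequence that grows by the factor `q > 1` up to a bounded error in each step stays
within a bounded distance of a multiple of `q ^ n`. -/
theorem exists_geometric_approx {q D : ℝ} (hq : 1 < q) {P : ℕ → ℝ}
    (h : ∀ n, |P (n + 1) - q * P n| ≤ D) :
    ∃ c K : ℝ, ∀ n, |P n - c * q ^ n| ≤ K := by
  have hq0 : 0 < q := zero_lt_one.trans hq
  have hr : q⁻¹ < 1 := inv_lt_one_of_one_lt₀ hq
  -- After normalisation by q ^ n the increments are summable. The tail of the geometric series,
  -- multiplied by q ^ n again, is the constant bound.
  have hstep : ∀ n, dist (P n / q ^ n) (P (n + 1) / q ^ (n + 1)) ≤ D / q * q⁻¹ ^ n := by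
    intro n
    rw [dist_comm, Real.dist_eq]
    have : P (n + 1) / q ^ (n + 1) - P n / q ^ n = (P (n + 1) - q * P n) / q ^ (n + 1) := by
      field_simp
      ring
    rw [this, abs_div, abs_of_pos (by positivity : 0 < q ^ (n + 1)), inv_pow, div_mul_eq_mul_div,
      ← div_eq_mul_inv, div_div, ← pow_succ]
    gcongr
    exact h n
  obtain ⟨c, hc⟩ := cauchySeq_tendsto_of_complete (cauchySeq_of_le_geometric _ _ hr hstep)
  refine ⟨c, D / q / (1 - q⁻¹), fun n => ?_⟩
  have h1 := dist_le_of_le_geometric_of_tendsto _ _ hr hstep hc n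
  rw [Real.dist_eq] at h1
  have hqn : 0 < q ^ n := by positivity
  have : P n - c * q ^ n = (P n / q ^ n - c) * q ^ n := by field_simp
  rw [this, abs_mul, abs_of_pos hqn]
  calc _ ≤ (D / q * q⁻¹ ^ n / (1 - q⁻¹)) * q ^ n := by gcongr
    _ = D / q / (1 - q⁻¹) := by
      rw [inv_pow]; field_simp

/-- Any K with |q| * K + D ≤ K bounds an interval that the recursion cannot leave. -/
theorem exists_contracting_bound {q D : ℝ} (hq : |q| < 1) {Q : ℕ → ℝ}
    (h : ∀ n, |Q (n + 1) - q * Q n| ≤ D) : ∃ K : ℝ, ∀ n, |Q n| ≤ K := by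
  have hq' : 0 < 1 - |q| := by linarith
  refine ⟨max |Q 0| (D / (1 - |q|)), fun n => ?_⟩
  induction n with
  | zero => exact le_max_left _ _
  | succ n ih =>
    set K := max |Q 0| (D / (1 - |q|))
    have hD : D ≤ K * (1 - |q|) := (div_le_iff₀ hq').mp (le_max_right _ _)
    have h1 : |Q (n + 1)| ≤ |Q (n + 1) - q * Q n| + |q * Q n| := by
      simpa using abs_add_le (Q (n + 1) - q * Q n) (q * Q n)
    rw [abs_mul] at h1
    have h2 : |q| * |Q n| ≤ |q| * K := by gcongr
    linarith [h n]

/-- The number of pairs in a supertile is proportional to its length up to a bounded error. -/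
theorem exists_pairCount_superWord (α β : Letter) (z : ℝ) : ∃ κ K : ℝ, ∀ n c,
    |(pairCount α β z (superWord n c) : ℝ) - κ * wordLength (superWord n c)| ≤ K := by
  set A : ℕ → ℝ := fun n => pairCount α β z (superWord n a)
  set B : ℕ → ℝ := fun n => pairCount α β z (superWord n b)
  set C : ℝ := 2 * |z| + 1
  have hs : √2 * √2 = 2 := Real.mul_self_sqrt (by norm_num)
  have hs0 : 0 < √2 := by positivity
  have hA : ∀ n, |A (n + 1) - (A n + 2 * B n)| ≤ 2 * C := by
    intro n
    have h1 := pairCount_append α β z (superWord n b) (superWord n b ++ superWord n a)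
    have h2 := pairCount_append α β z (superWord n b) (superWord n a)
    rw [← superWord_succ_a] at h1
    rw [abs_le] at h1 h2 ⊢
    simp only [A, B]
    constructor <;> linarith [h1.1, h1.2, h2.1, h2.2]
  have hB : ∀ n, |B (n + 1) - (A n + B n)| ≤ C := by
    intro n
    have h1 := pairCount_append α β z (superWord n a) (superWord n b)
    rwa [← superWord_succ_b] at h1
  -- The combinations A ± √2 * B diagonalise the recursion (A, B) ↦ (A + 2 * B, A + B), with
  -- eigenvalues 1 ± √2.
  have hP : ∀ n, |(A (n + 1) + √2 * B (n + 1)) - infl * (A n + √2 * B n)| ≤ 2 * C + √2 * C := by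
    intro n
    have : (A (n + 1) + √2 * B (n + 1)) - infl * (A n + √2 * B n) =
        (A (n + 1) - (A n + 2 * B n)) + √2 * (B (n + 1) - (A n + B n)) := by
      unfold infl; linear_combination -B n * hs
    rw [this]
    refine (abs_add_le _ _).trans (add_le_add (hA n) ?_)
    rw [abs_mul, abs_of_pos hs0]
    exact mul_le_mul_of_nonneg_left (hB n) hs0.le
  have hQ : ∀ n, |(A (n + 1) - √2 * B (n + 1)) - (1 - √2) * (A n - √2 * B n)| ≤
      2 * C + √2 * C := by
    intro n
    have : (A (n + 1) - √2 * B (n + 1)) - (1 - √2) * (A n - √2 * B n) =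
        (A (n + 1) - (A n + 2 * B n)) - √2 * (B (n + 1) - (A n + B n)) := by
      linear_combination -B n * hs
    rw [this]
    refine (abs_sub _ _).trans (add_le_add (hA n) ?_)
    rw [abs_mul, abs_of_pos hs0]
    exact mul_le_mul_of_nonneg_left (hB n) hs0.le
  obtain ⟨c, K₁, h₁⟩ := exists_geometric_approx (P := fun n => A n + √2 * B n) one_lt_infl hP
  obtain ⟨K₂, h₂⟩ := exists_contracting_bound (q := 1 - √2) (Q := fun n => A n - √2 * B n) (by
    rw [abs_lt]; constructor <;> nlinarith) hQ
  -- If A and B are close to κ times the lengths `infl` ^ n * √2 and `infl` ^ n, then A + √2 * B is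
  -- close to 2 * √2 * κ * `infl` ^ n.
  have hc : c = c / (2 * √2) * (2 * √2) := by field_simp
  set κ := c / (2 * √2)
  refine ⟨κ, K₁ + K₂, fun n d => ?_⟩
  rw [wordLength_superWord]
  have h1 := abs_le.mp (h₁ n)
  have h2 := abs_le.mp (h₂ n)
  rw [hc] at h1
  cases d
  · change |A n - κ * (infl ^ n * √2)| ≤ _
    rw [abs_le]
    have h3 := (abs_nonneg _).trans (h₁ n)
    have h4 := (abs_nonneg _).trans (h₂ n)
    constructor <;> linarith [h1.1, h1.2, h2.1, h2.2]
  · change |B n - κ * (infl ^ n * 1)| ≤ _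
    have h3 : |√2 * (2 * (B n - κ * (infl ^ n * 1)))| ≤ K₁ + K₂ := by
      rw [abs_le]
      constructor <;> linarith [h1.1, h1.2, h2.1, h2.2]
    rw [abs_mul, abs_mul, abs_of_pos hs0, abs_of_pos (two_pos : (0 : ℝ) < 2)] at h3
    have h4 : (1 : ℝ) ≤ √2 := one_le_tileLength a
    nlinarith [abs_nonneg (B n - κ * (infl ^ n * 1))]

/-! ### Uniform estimates on prefixes and suffixes -/

/-- A nearly additive function that is bounded on the prefixes of the blocks `f c` and small on the
blocks is small on all prefixes of concatenations of blocks. -/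
theorem le_of_prefix_flatMap {E : List Letter → ℝ} {f : Letter → List Letter} {C K s l : ℝ}
    (hs : 0 ≤ s) (hadd : ∀ u v, E (u ++ v) ≤ E u + E v + C) (hf : ∀ c, E (f c) + C ≤ s * l)
    (hl : ∀ c, l ≤ wordLength (f c)) (hK : ∀ c u, u <+: f c → E u ≤ K) (v u : List Letter)
    (hu : u <+: v.flatMap f) (h0 : E [] ≤ K) : E u ≤ s * wordLength u + K := by
  induction v generalizing u with
  | nil =>
    obtain rfl : u = [] := by simpa using hu
    simpa using h0
  | cons c v ih =>
    rw [List.flatMap_cons] at hu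
    by_cases hlen : u.length ≤ (f c).length
    · have h1 := hK c u (List.prefix_of_prefix_length_le hu (List.prefix_append _ _) hlen)
      have := mul_nonneg hs (wordLength_nonneg u)
      linarith
    -- A complete first block is split off: its error and the seam constant C together are paid for
    -- by s times its length.
    · obtain ⟨t, rfl⟩ :=
        List.prefix_of_prefix_length_le (List.prefix_append _ _) hu (le_of_not_ge hlen)
      have h1 := ih t ((List.prefix_append_right_inj _).mp hu)
      have h2 := mul_le_mul_of_nonneg_left (hl c) hs
      rw [wordLength_append, mul_add]
      linarith [hadd (f c) t, hf c]

theorem wordLength_mono_prefix {u v : List Letter} (h : u <+: v) : wordLength u ≤ wordLength v := by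
  obtain ⟨t, rfl⟩ := h
  simpa using wordLength_nonneg t

/-- The number of pairs is proportional to the length, with a uniform error, on prefixes and
suffixes of the words `level n`. -/
theorem exists_pairCount_uniform {α β : Letter} {z κ K₀ : ℝ}
    (hκ : ∀ n c,
      |(pairCount α β z (superWord n c) : ℝ) - κ * wordLength (superWord n c)| ≤ K₀)
    {ε : ℝ} (hε : 0 < ε) : ∃ K : ℝ, ∀ n, ∀ u : List Letter, u <+: level n ∨ u <:+ level n →
      |(pairCount α β z u : ℝ) - κ * wordLength u| ≤ ε * wordLength u + K := by
  set C : ℝ := 2 * |z| + 1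
  set E : List Letter → ℝ := fun u => |(pairCount α β z u : ℝ) - κ * wordLength u|
  have hadd : ∀ u v, E (u ++ v) ≤ E u + E v + C := by
    intro u v
    have h := pairCount_append α β z u v
    simp only [E, wordLength_append]
    have : (pairCount α β z (u ++ v) : ℝ) - κ * (wordLength u + wordLength v) =
      ((pairCount α β z u : ℝ) - κ * wordLength u) + ((pairCount α β z v : ℝ) - κ * wordLength v)
        + ((pairCount α β z (u ++ v) : ℝ) - (pairCount α β z u + pairCount α β z v)) := by ring
    rw [this]
    exact (abs_add_le _ _).trans (add_le_add (abs_add_le _ _) h)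
  have htriv : ∀ u, E u ≤ (1 + |κ|) * wordLength u := by
    intro u
    have h1 : (pairCount α β z u : ℝ) ≤ wordLength u :=
      le_trans (by exact_mod_cast pairCount_le_length α β z u) (length_le_wordLength u)
    calc E u ≤ |(pairCount α β z u : ℝ)| + |κ * wordLength u| := abs_sub _ _
      _ = pairCount α β z u + |κ| * wordLength u := by
        rw [abs_mul, abs_of_nonneg (wordLength_nonneg u), Nat.abs_cast]
      _ ≤ _ := by linarith
  -- The blocks are supertiles of a level m so high that the bounded error per block and seam is at
  -- most ε times the block length.
  obtain ⟨m, hm⟩ : ∃ m : ℕ, (K₀ + C) / ε < infl ^ m := pow_unbounded_of_one_lt _ one_lt_infl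
  have hm' : K₀ + C ≤ ε * infl ^ m := by rw [div_lt_iff₀ hε] at hm; linarith
  have hpos : 0 < infl ^ m := pow_pos infl_pos m
  have hblock : ∀ c, E (superWord m c) + C ≤ ε * infl ^ m := fun c => by
    have := hκ m c
    simp only [E]; linarith
  have hlen : ∀ c, infl ^ m ≤ wordLength (superWord m c) := fun c => by
    rw [wordLength_superWord]
    exact le_mul_of_one_le_right hpos.le (one_le_tileLength c)
  have hlen' : ∀ c, wordLength (superWord m c) ≤ infl ^ m * √2 := fun c => by
    rw [wordLength_superWord]
    exact mul_le_mul_of_nonneg_left (tileLength_le c) hpos.le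
  have hnil : E [] = 0 := by simp [E, pairCount, matchCount]
  have hκ0 : 0 ≤ 1 + |κ| := by positivity
  -- K is the crude bound `htriv` for a patch no longer than the longest block.
  set K := (1 + |κ|) * (infl ^ m * √2)
  have hK0 : 0 ≤ K := mul_nonneg hκ0 (mul_nonneg hpos.le (Real.sqrt_nonneg 2))
  have hpre : ∀ v u, u <+: substWord^[m] v → E u ≤ ε * wordLength u + K := by
    intro v u hu
    rw [substWord_iterate] at hu
    refine le_of_prefix_flatMap hε.le hadd hblock hlen (fun c u hu => ?_) v u hu (hnil.trans_le hK0)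
    exact (htriv u).trans (mul_le_mul_of_nonneg_left
      ((wordLength_mono_prefix hu).trans (hlen' c)) hκ0)
  have hsuf : ∀ v u, u <:+ substWord^[m] v → E u ≤ ε * wordLength u + K := by
    intro v u hu
    -- Reversal turns suffixes into prefixes of a concatenation of reversed blocks; E is read
    -- through the reversal as well.
    rw [substWord_iterate, ← List.reverse_prefix, List.reverse_flatMap] at hu
    have := le_of_prefix_flatMap (E := fun u => E u.reverse) (C := C) (K := K) (s := ε)
      (l := infl ^ m) hε.le
      (fun u v => by simpa [add_comm] using hadd v.reverse u.reverse)
      (f := List.reverse ∘ superWord m) (by simpa using hblock) (by simpa using hlen)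
      (fun c u hu => ?_) v.reverse u.reverse hu (hnil.trans_le hK0)
    · simpa using this
    · refine (htriv _).trans (mul_le_mul_of_nonneg_left ?_ hκ0)
      rw [wordLength_reverse]
      refine (wordLength_mono_prefix hu).trans ?_
      simpa using hlen' c
  refine ⟨K, fun n u hu => ?_⟩
  rcases le_total m n with hmn | hmn
  · obtain ⟨k, rfl⟩ := Nat.exists_eq_add_of_le hmn
    have h : level (m + k) = substWord^[m] (level k) := by
      rw [level, Function.iterate_add_apply, ← level]
    rw [h] at hu
    change E u ≤ _
    rcases hu with hu | hu
    · linarith [hpre _ u hu]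
    · linarith [hsuf _ u hu]
  · have h1 : wordLength u ≤ wordLength (superWord n a) := by
      rcases hu with hu | hu
      · exact wordLength_mono_prefix hu
      · simpa [superWord, level] using wordLength_mono_prefix (List.reverse_prefix.mpr hu)
    have h2 : wordLength (superWord n a) ≤ infl ^ m * √2 := by
      rw [wordLength_superWord]
      exact mul_le_mul_of_nonneg_right (pow_le_pow_right₀ one_lt_infl.le hmn) (Real.sqrt_nonneg 2)
    have h3 := htriv u
    have h4 := mul_le_mul_of_nonneg_left (h1.trans h2) hκ0
    have h5 := mul_nonneg hε.le (wordLength_nonneg u)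
    change E u ≤ _
    linarith

/-! ### Windows of bi-infinite words -/

/-- The `k` letters of `w` from position `m` on. -/
def window (w : ℤ → Letter) (m : ℤ) (k : ℕ) : List Letter :=
  (List.range k).map fun i : ℕ => w (m + i)

theorem window_succ (w : ℤ → Letter) (m : ℤ) (k : ℕ) :
    window w m (k + 1) = w m :: window w (m + 1) k := by
  simp [window, List.range_succ_eq_map, Function.comp_def, add_left_comm, add_comm]

theorem window_add (w : ℤ → Letter) (m : ℤ) (j k : ℕ) :
    window w m (j + k) = window w m j ++ window w (m + j) k := by
  simp [window, List.range_add, Function.comp_def, add_assoc]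

@[simp] theorem length_window (w : ℤ → Letter) (m : ℤ) (k : ℕ) : (window w m k).length = k := by
  simp [window]

theorem window_right_prefix (p : Fin 2) (k : ℕ) :
    window (biWord p) 0 k <+: level (2 * k + p) := by
  have hk : k < (level (2 * k + p)).length :=
    lt_of_le_of_lt (by omega) (length_lt_level (2 * k + p))
  have h : window (biWord p) 0 k = (level (2 * k + p)).take k := by
    refine List.ext_getElem (by simp [hk.le]) fun i h1 h2 => ?_
    rw [length_window] at h1
    simpa [window] using bi_word_right p k i (h1.trans hk)
  rw [h]
  exact List.take_prefix _ _

theorem window_left_suffix (p : Fin 2) (k : ℕ) :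
    window (biWord p) (-k) k <:+ level (2 * k + p) := by
  have hk : k < (level (2 * k + p)).length :=
    lt_of_le_of_lt (by omega) (length_lt_level (2 * k + p))
  have h : window (biWord p) (-k) k =
      (level (2 * k + p)).drop ((level (2 * k + p)).length - k) := by
    refine List.ext_getElem (by simp; omega) fun i h1 h2 => ?_
    rw [length_window] at h1
    have h3 := bi_word_left p k (k - 1 - i) (by omega)
    rw [List.getElem_reverse] at h3
    -- Position i from the left end of the window is position k - 1 - i leftwards from the origin.
    have h4 : (-(k : ℤ) + i) = -((k - 1 - i : ℕ) : ℤ) - 1 := by omega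
    simp only [window, List.getElem_map, List.getElem_range, List.getElem_drop, h4, h3]
    congr 1
    omega
  rw [h]
  exact List.drop_suffix _ _

theorem leftEnd_zero (w : ℤ → Letter) : leftEnd w 0 = 0 := by simp [leftEnd]

theorem leftEnd_succ (w : ℤ → Letter) (n : ℤ) :
    leftEnd w (n + 1) = leftEnd w n + tileLength (w n) := by
  unfold leftEnd
  rcases lt_or_ge n 0 with hn | hn
  · have h1 : Finset.Ico 0 n = ∅ := Finset.Ico_eq_empty (by omega)
    have h2 : Finset.Ico 0 (n + 1) = ∅ := Finset.Ico_eq_empty (by omega)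
    have h3 : Finset.Ico n 0 = insert n (Finset.Ico (n + 1) 0) := by
      ext i; simp only [Finset.mem_Ico, Finset.mem_insert]; omega
    rw [h1, h2, h3, Finset.sum_insert (by simp)]
    ring
  · have h1 : Finset.Ico n 0 = ∅ := Finset.Ico_eq_empty (by omega)
    have h2 : Finset.Ico (n + 1) 0 = ∅ := Finset.Ico_eq_empty (by omega)
    have h3 : Finset.Ico 0 (n + 1) = insert n (Finset.Ico 0 n) := by
      ext i; simp only [Finset.mem_Ico, Finset.mem_insert]; omega
    rw [h1, h2, h3, Finset.sum_insert (by simp)]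
    ring

theorem leftEnd_strictMono (w : ℤ → Letter) : StrictMono (leftEnd w) :=
  strictMono_int_of_lt_succ fun n => by
    have := one_le_tileLength (w n)
    rw [leftEnd_succ]; linarith

theorem leftEnd_add_nat (w : ℤ → Letter) (m : ℤ) (k : ℕ) :
    leftEnd w (m + k) = leftEnd w m + wordLength (window w m k) := by
  induction k generalizing m with
  | zero => simp [window]
  | succ k ih =>
    rw [window_succ, wordLength_cons, ← add_assoc, ← leftEnd_succ, ← ih]
    congr 1
    push_cast
    ring

theorem mem_pts_window {w : ℤ → Letter} {α : Letter} {m : ℤ} {k : ℕ} {x : ℝ} :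
    x ∈ pts α (window w m k) ↔
      ∃ i : ℤ, m ≤ i ∧ i < m + k ∧ w i = α ∧ leftEnd w i = leftEnd w m + x := by
  induction k generalizing m x with
  | zero =>
    simp only [window, List.range_zero, List.map_nil, pts_nil, Multiset.notMem_zero, false_iff]
    rintro ⟨i, h1, h2, -⟩
    push_cast at h2
    omega
  | succ k ih =>
    rw [window_succ, pts_cons, Multiset.mem_add, Multiset.mem_map]
    constructor
    · rintro (h | ⟨y, hy, rfl⟩)
      · split_ifs at h with hα
        · rw [Multiset.mem_singleton] at h
          exact ⟨m, le_rfl, by push_cast; omega, hα, by simp [h]⟩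
        · simp at h
      · obtain ⟨i, h1, h2, h3, h4⟩ := ih.mp hy
        refine ⟨i, by omega, by push_cast; omega, h3, ?_⟩
        rw [h4, leftEnd_succ]; ring
    · rintro ⟨i, h1, h2, h3, h4⟩
      rcases h1.eq_or_lt with rfl | h1
      · left
        simpa [h3] using h4
      · right
        refine ⟨x - tileLength (w m), ih.mpr ⟨i, by omega, by push_cast at h2; omega, h3, ?_⟩,
          by ring⟩
        rw [h4, leftEnd_succ]; ring

/-- The tiles whose left endpoints lie in a ball around the origin form a window. -/
theorem exists_window_ball (w : ℤ → Letter) {r : ℝ} (hr : 0 < r) : ∃ j l : ℕ,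
    (∀ i : ℤ, |leftEnd w i| < r ↔ -(j : ℤ) ≤ i ∧ i < -(j : ℤ) + (j + l : ℕ)) ∧
      |wordLength (window w (-j) (j + l)) - 2 * r| ≤ √2 := by
  classical
  have hl : ∃ l : ℕ, r ≤ leftEnd w l := by
    obtain ⟨l, hl⟩ := exists_nat_ge r
    refine ⟨l, hl.trans ?_⟩
    have h := leftEnd_add_nat w 0 l
    rw [zero_add, leftEnd_zero, zero_add] at h
    rw [h]
    simpa using length_le_wordLength (window w 0 l)
  have hj : ∃ j : ℕ, leftEnd w (-j - 1) ≤ -r := by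
    obtain ⟨j, hj⟩ := exists_nat_ge r
    refine ⟨j, ((leftEnd_strictMono w).monotone (by omega : -(j : ℤ) - 1 ≤ -j)).trans ?_⟩
    have h := leftEnd_add_nat w (-j) j
    rw [neg_add_cancel, leftEnd_zero] at h
    have := length_le_wordLength (window w (-j) j)
    rw [length_window] at this
    linarith
  -- Tile l is the first one starting at or beyond r, and l is positive because tile 0 starts at 0 <
  -- r. Each end of the window then overshoots the ball's endpoint by at most one tile length.
  obtain ⟨l, hl1, hl2⟩ : ∃ l : ℕ, r ≤ leftEnd w l ∧ leftEnd w (l - 1) < r := by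
    refine ⟨Nat.find hl, Nat.find_spec hl, ?_⟩
    rcases h : Nat.find hl with _ | n
    · have := Nat.find_spec hl
      rw [h, Nat.cast_zero, leftEnd_zero] at this
      linarith
    · have := Nat.find_min hl (m := n) (by omega)
      push Not at this
      simpa using this
  obtain ⟨j, hj1, hj2⟩ : ∃ j : ℕ, leftEnd w (-j - 1) ≤ -r ∧ -r < leftEnd w (-j) := by
    refine ⟨Nat.find hj, Nat.find_spec hj, ?_⟩
    rcases h : Nat.find hj with _ | n
    · simpa [leftEnd_zero] using hr
    · have := Nat.find_min hj (m := n) (by omega)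
      push Not at this
      refine this.trans_eq ?_
      congr 1
      push_cast
      ring
  have hmono := leftEnd_strictMono w
  have hend : -(j : ℤ) + (j + l : ℕ) = l := by push_cast; ring
  refine ⟨j, l, fun i => ?_, ?_⟩
  · rw [hend, abs_lt]
    constructor
    · rintro ⟨h1, h2⟩
      have h3 := hmono.lt_iff_lt.mp (hj1.trans_lt h1)
      have h4 := hmono.lt_iff_lt.mp (h2.trans_le hl1)
      omega
    · rintro ⟨h1, h2⟩
      exact ⟨hj2.trans_le (hmono.monotone h1),
        (hmono.monotone (by omega : i ≤ l - 1)).trans_lt hl2⟩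
  · have h1 := leftEnd_add_nat w (-j) (j + l)
    rw [hend] at h1
    have h2 := leftEnd_succ w (l - 1)
    have h3 := leftEnd_succ w (-j - 1)
    rw [sub_add_cancel] at h2 h3
    have h4 := tileLength_le (w (l - 1))
    have h5 := tileLength_le (w (-j - 1))
    rw [abs_le]
    constructor <;> linarith

/-! ### Pair counts in balls -/

/-- The number of pairs of control points at distance `z` in the ball of radius `r`. -/
noncomputable def ballCount (w : ℤ → Letter) (α β : Letter) (z r : ℝ) : ℕ :=
  {x | x ∈ controlPoints w α ∩ Metric.ball 0 r ∧
    x + z ∈ controlPoints w β ∩ Metric.ball 0 r}.ncard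

theorem mem_controlPoints_ball {w : ℤ → Letter} {r : ℝ} {m : ℤ} {k : ℕ}
    (h : ∀ i : ℤ, |leftEnd w i| < r ↔ m ≤ i ∧ i < m + k) (α : Letter) (x : ℝ) :
    x ∈ controlPoints w α ∩ Metric.ball 0 r ↔ x - leftEnd w m ∈ pts α (window w m k) := by
  rw [mem_pts_window]
  simp only [controlPoints, Set.mem_inter_iff, Set.mem_ofPred_eq, mem_ball_zero_iff,
    Real.norm_eq_abs, add_sub_cancel]
  constructor
  · rintro ⟨⟨n, h1, rfl⟩, h2⟩
    exact ⟨n, ((h n).mp h2).1, ((h n).mp h2).2, h1, rfl⟩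
  · rintro ⟨n, h1, h2, h3, rfl⟩
    exact ⟨⟨n, h3, rfl⟩, (h n).mpr ⟨h1, h2⟩⟩

theorem ballCount_eq {w : ℤ → Letter} {r : ℝ} {m : ℤ} {k : ℕ}
    (h : ∀ i : ℤ, |leftEnd w i| < r ↔ m ≤ i ∧ i < m + k) (α β : Letter) (z : ℝ) :
    ballCount w α β z r = pairCount α β z (window w m k) := by
  classical
  set S := pts α (window w m k)
  set T := pts β (window w m k)
  have hS : S.Nodup := pts_nodup _ _
  have : {x | x ∈ controlPoints w α ∩ Metric.ball 0 r ∧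
      x + z ∈ controlPoints w β ∩ Metric.ball 0 r} =
      (leftEnd w m + ·) '' (↑(S.filter fun x => x + z ∈ T).toFinset : Set ℝ) := by
    ext x
    rw [Set.mem_ofPred_eq, mem_controlPoints_ball h, mem_controlPoints_ball h]
    simp only [Set.mem_image, Finset.mem_coe, Multiset.mem_toFinset, Multiset.mem_filter]
    constructor
    · rintro ⟨h1, h2⟩
      exact ⟨x - leftEnd w m, ⟨h1, by rwa [sub_add_eq_add_sub]⟩, by ring⟩
    · rintro ⟨y, ⟨h1, h2⟩, rfl⟩
      refine ⟨by rwa [add_sub_cancel_left], ?_⟩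
      rwa [add_assoc, add_sub_cancel_left]
  rw [ballCount, this, Set.ncard_image_of_injective _ (add_right_injective _),
    Set.ncard_coe_finset, Multiset.toFinset_card_of_nodup (hS.filter _), pairCount,
    matchCount_eq_card_filter (pts_nodup _ _)]

theorem finite_controlPoints_ball (w : ℤ → Letter) (α : Letter) (r : ℝ) :
    (controlPoints w α ∩ Metric.ball 0 r).Finite := by
  classical
  rcases le_or_gt r 0 with hr | hr
  · simp [Metric.ball_eq_empty.mpr hr]
  · obtain ⟨j, l, h, -⟩ := exists_window_ball w hr
    refine ((pts α (window w (-j) (j + l))).toFinset.finite_toSet.image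
      (leftEnd w (-j) + ·)).subset fun x hx => ?_
    rw [mem_controlPoints_ball h] at hx
    exact ⟨x - leftEnd w (-j), by simpa using hx, by ring⟩

/-- A pair of equal type at distance 0 is a single control point, so the denominator of `relFreq` is
also governed by pair counts. -/
theorem ncard_allControlPoints_ball (w : ℤ → Letter) (r : ℝ) :
    (allControlPoints w ∩ Metric.ball 0 r).ncard = ballCount w a a 0 r + ballCount w b b 0 r := by
  have h1 : allControlPoints w ∩ Metric.ball 0 r =
      (controlPoints w a ∩ Metric.ball 0 r) ∪ (controlPoints w b ∩ Metric.ball 0 r) := by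
    rw [← Set.union_inter_distrib_right]
    congr 1
    ext x
    simp only [allControlPoints, Set.mem_iUnion, Set.mem_union]
    constructor
    · rintro ⟨_ | _, h⟩
      · exact Or.inl h
      · exact Or.inr h
    · rintro (h | h)
      exacts [⟨a, h⟩, ⟨b, h⟩]
  have h2 : Disjoint (controlPoints w a ∩ Metric.ball 0 r)
      (controlPoints w b ∩ Metric.ball 0 r) := by
    rw [Set.disjoint_left]
    rintro _ ⟨⟨n, hn, rfl⟩, -⟩ ⟨⟨m, hm, hmn⟩, -⟩
    rw [(leftEnd_strictMono w).injective hmn, hn] at hm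
    cases hm
  rw [h1, Set.ncard_union_eq h2 (finite_controlPoints_ball _ _ _) (finite_controlPoints_ball _ _ _)]
  have h3 : ∀ α, ballCount w α α 0 r = (controlPoints w α ∩ Metric.ball 0 r).ncard := fun α => by
    simp only [ballCount, add_zero, and_self, Set.ofPred_mem_eq]
  rw [h3, h3]

/-! ### Limits -/

theorem tendsto_div_of_forall_approx {F : ℝ → ℝ} {c : ℝ}
    (h : ∀ ε > 0, ∃ K : ℝ, ∀ r > 0, |F r - c * r| ≤ ε * r + K) :
    Tendsto (fun r => F r / r) atTop (𝓝 c) := by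
  rw [Metric.tendsto_atTop]
  intro ε hε
  obtain ⟨K, hK⟩ := h (ε / 2) (by positivity)
  refine ⟨max 1 (2 * K / ε + 1), fun r hr => ?_⟩
  have h1 : 1 ≤ r := (le_max_left _ _).trans hr
  have h2 : 2 * K / ε + 1 ≤ r := (le_max_right _ _).trans hr
  have hr0 : 0 < r := by linarith
  have h3 : 2 * K < r * ε := (div_lt_iff₀ hε).mp (by linarith)
  have h4 : F r / r - c = (F r - c * r) / r := by field_simp
  rw [Real.dist_eq, h4, abs_div, abs_of_pos hr0, div_lt_iff₀ hr0]
  linarith [hK r hr0]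

/-! ### Pair densities and their renormalisation -/

/-- The number `κ α β z` is the number of pairs at distance `z` per unit length in supertiles. -/
def IsPairDensity (κ : Letter → Letter → ℝ → ℝ) : Prop :=
  ∀ α β z, ∃ K : ℝ, ∀ n c,
    |(pairCount α β z (superWord n c) : ℝ) - κ α β z * wordLength (superWord n c)| ≤ K

theorem exists_isPairDensity : ∃ κ, IsPairDensity κ := by
  choose κ h using exists_pairCount_superWord
  exact ⟨κ, h⟩

namespace IsPairDensity

variable {κ : Letter → Letter → ℝ → ℝ}

theorem tendsto_ballCount (hκ : IsPairDensity κ) (p : Fin 2) (α β : Letter) (z : ℝ) :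
    Tendsto (fun r => (ballCount (biWord p) α β z r : ℝ) / r) atTop (𝓝 (2 * κ α β z)) := by
  obtain ⟨K₀, hK₀⟩ := hκ α β z
  refine tendsto_div_of_forall_approx fun ε hε => ?_
  obtain ⟨K, hK⟩ := exists_pairCount_uniform hK₀ (half_pos hε)
  -- The terms come from the two half-windows, the seam at the origin, and the deviation, at most
  -- √2, of the window length from 2 * r.
  refine ⟨2 * K + (2 * |z| + 1) + (ε / 2 + |κ α β z|) * √2, fun r hr => ?_⟩
  obtain ⟨j, l, hjl, hlen⟩ := exists_window_ball (biWord p) hr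
  rw [ballCount_eq hjl]
  rw [window_add, wordLength_append] at hlen
  rw [window_add]
  have h0 := pairCount_append α β z (window (biWord p) (-j) j) (window (biWord p) (-j + j) l)
  rw [neg_add_cancel] at *
  have h1 := hK _ _ (Or.inr (window_left_suffix p j))
  have h2 := hK _ _ (Or.inl (window_right_prefix p l))
  set u := window (biWord p) (-j) j
  set v := window (biWord p) 0 l
  set k := κ α β z
  have h3 : |k * (wordLength u + wordLength v - 2 * r)| ≤ |k| * √2 := by
    rw [abs_mul]
    exact mul_le_mul_of_nonneg_left hlen (abs_nonneg _)
  have h4 := mul_le_mul_of_nonneg_left (abs_le.mp hlen).2 (half_pos hε).le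
  rw [abs_le] at h0 h1 h2 h3 ⊢
  constructor <;> linarith [h0.1, h0.2, h1.1, h1.2, h2.1, h2.2, h3.1, h3.2]

theorem tendsto_level (hκ : IsPairDensity κ) (α β : Letter) (z : ℝ) :
    Tendsto (fun n => (pairCount α β z (level n) : ℝ) / wordLength (level n)) atTop
      (𝓝 (κ α β z)) := by
  obtain ⟨K, hK⟩ := hκ α β z
  have hlen : ∀ n, wordLength (level n) = infl ^ n * √2 := fun n => wordLength_superWord n a
  have hpos : ∀ n, 0 < wordLength (level n) := fun n => by
    rw [hlen]; exact mul_pos (pow_pos infl_pos n) (by positivity)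
  have hinf : Tendsto (fun n => wordLength (level n)) atTop atTop := by
    simp only [hlen]
    exact (tendsto_pow_atTop_atTop_of_one_lt one_lt_infl).atTop_mul_const (by positivity)
  rw [tendsto_iff_dist_tendsto_zero]
  refine squeeze_zero (fun _ => dist_nonneg) (fun n => ?_) (hinf.const_div_atTop K)
  have h : (pairCount α β z (level n) : ℝ) / wordLength (level n) - κ α β z =
      (pairCount α β z (level n) - κ α β z * wordLength (level n)) / wordLength (level n) := by
    have := (hpos n).ne'
    field_simp
  rw [Real.dist_eq, h, abs_div, abs_of_pos (hpos n)]
  exact div_le_div_of_nonneg_right (hK n a) (hpos n).le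

theorem tendsto_level_succ (hκ : IsPairDensity κ) (α β : Letter) (z : ℝ) :
    Tendsto (fun n => (pairCount α β z (substWord (level n)) : ℝ) / wordLength (level n)) atTop
      (𝓝 (infl * κ α β z)) := by
  refine (((tendsto_add_atTop_iff_nat 1).mpr (hκ.tendsto_level α β z)).const_mul infl).congr
    fun n => ?_
  have h : level (n + 1) = substWord (level n) := by
    simp only [level, Function.iterate_succ_apply']
  have := infl_pos.ne'
  rw [h, wordLength_substWord]
  field_simp

/-- Both sides are limits of the same quotient, the pair count of the inflated word over the length
of the original one; the exact finite relations evaluate it term by term. -/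
theorem renormRelationsAt (hκ : IsPairDensity κ) (z : ℝ) : RenormRelationsAt κ z := by
  have T := hκ.tendsto_level
  refine ⟨tendsto_nhds_unique (hκ.tendsto_level_succ a a z) ?_,
    tendsto_nhds_unique (hκ.tendsto_level_succ a b z) ?_,
    tendsto_nhds_unique (hκ.tendsto_level_succ b a z) ?_,
    tendsto_nhds_unique (hκ.tendsto_level_succ b b z) ?_⟩
  · simp only [pairCount_substWord_aa, Nat.cast_add, add_div]
    exact (((T _ _ _).add (T _ _ _)).add (T _ _ _)).add (T _ _ _)
  · simp only [pairCount_substWord_ab, Nat.cast_add, add_div]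
    exact (((((T _ _ _).add (T _ _ _)).add (T _ _ _)).add (T _ _ _)).add (T _ _ _)).add (T _ _ _)
  · simp only [pairCount_substWord_ba, Nat.cast_add, add_div]
    exact (((((T _ _ _).add (T _ _ _)).add (T _ _ _)).add (T _ _ _)).add (T _ _ _)).add (T _ _ _)
  · simp only [pairCount_substWord_bb, Nat.cast_add, Nat.cast_mul, Nat.cast_ofNat, add_div,
      mul_div_assoc]
    exact ((((((((T _ _ _).const_mul 2).add (T _ _ _)).add (T _ _ _)).add (T _ _ _)).add
      (T _ _ _)).add (T _ _ _)).add (T _ _ _)).add (T _ _ _)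

/-- The density of control points is positive. -/
theorem density_pos (hκ : IsPairDensity κ) : 0 < κ a a 0 + κ b b 0 := by
  -- Tiles have length at most √2, so every patch has at least 1 / √2 control points per unit
  -- length.
  refine lt_of_lt_of_le (by positivity : 0 < 1 / √2)
    (ge_of_tendsto' ((hκ.tendsto_level a a 0).add (hκ.tendsto_level b b 0)) fun n => ?_)
  have hpos : 0 < wordLength (level n) :=
    lt_of_lt_of_le (by exact_mod_cast (Nat.zero_le n).trans_lt (length_lt_level n))
      (length_le_wordLength _)
  rw [pairCount_self_zero, pairCount_self_zero, ← add_div, div_le_div_iff₀ (by positivity) hpos,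
    ← Nat.cast_add, card_pts_add_card_pts, one_mul, mul_comm]
  exact wordLength_le_length _

theorem tendsto_relFreq (hκ : IsPairDensity κ) (p : Fin 2) (α β : Letter) (z : ℝ) :
    Tendsto (relFreq (biWord p) α β z) atTop (𝓝 (κ α β z / (κ a a 0 + κ b b 0))) := by
  set num : ℝ → ℝ := fun r => ({x | x ∈ controlPoints (biWord p) α ∩ Metric.ball 0 r ∧
    x + z ∈ controlPoints (biWord p) β}.ncard : ℝ)
  have hlow : ∀ r, (ballCount (biWord p) α β z r : ℝ) ≤ num r := fun r => by
    refine Nat.cast_le.mpr (Set.ncard_le_ncard (fun x hx => ⟨hx.1, hx.2.1⟩) ?_)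
    exact (finite_controlPoints_ball _ _ _).subset fun x hx => hx.1
  -- In `relFreq` the second point may leave the ball, but only by |z|. Enlarging the radius by this
  -- constant does not affect the limit.
  have hupp : ∀ r, num r ≤ ballCount (biWord p) α β z (r + |z|) := fun r => by
    refine Nat.cast_le.mpr (Set.ncard_le_ncard (fun x hx => ?_) ?_)
    · have h := hx.1.2
      rw [mem_ball_zero_iff, Real.norm_eq_abs] at h
      refine ⟨⟨hx.1.1, ?_⟩, hx.2, ?_⟩
      · rw [mem_ball_zero_iff, Real.norm_eq_abs]
        linarith [abs_nonneg z]
      · rw [mem_ball_zero_iff, Real.norm_eq_abs]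
        linarith [abs_add_le x z]
    · exact (finite_controlPoints_ball _ _ _).subset fun x hx => hx.1
  have hshift : Tendsto (fun r => (ballCount (biWord p) α β z (r + |z|) : ℝ) / r) atTop
      (𝓝 (2 * κ α β z)) := by
    have h1 := (hκ.tendsto_ballCount p α β z).comp (tendsto_atTop_add_const_right _ |z| tendsto_id)
    have h2 : Tendsto (fun r : ℝ => 1 + |z| / r) atTop (𝓝 1) := by
      simpa using (tendsto_id.const_div_atTop |z|).const_add (1 : ℝ)
    have h3 := h1.mul h2
    rw [mul_one] at h3
    refine h3.congr' ?_
    filter_upwards [eventually_gt_atTop 0] with r hr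
    have : r + |z| ≠ 0 := by positivity
    simp only [Function.comp_apply, id]
    field_simp
  have hnum : Tendsto (fun r => num r / r) atTop (𝓝 (2 * κ α β z)) := by
    refine tendsto_of_tendsto_of_tendsto_of_le_of_le' (hκ.tendsto_ballCount p α β z) hshift ?_ ?_
    · filter_upwards [eventually_gt_atTop 0] with r hr
      exact div_le_div_of_nonneg_right (hlow r) hr.le
    · filter_upwards [eventually_gt_atTop 0] with r hr
      exact div_le_div_of_nonneg_right (hupp r) hr.le
  have hpos := hκ.density_pos
  have hden := (hκ.tendsto_ballCount p a a 0).add (hκ.tendsto_ballCount p b b 0)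
  have h := hnum.div hden (by linarith)
  rw [← mul_add, mul_div_mul_left _ _ two_ne_zero] at h
  refine h.congr' ?_
  filter_upwards [eventually_gt_atTop 0] with r hr
  simp only [Pi.div_apply]
  rw [← add_div, div_div_div_cancel_right₀ hr.ne', relFreq, ncard_allControlPoints_ball,
    Nat.cast_add]

theorem pairCorr_eq (hκ : IsPairDensity κ) (p : Fin 2) (α β : Letter) (z : ℝ) :
    pairCorr (biWord p) α β z = κ α β z / (κ a a 0 + κ b b 0) :=
  (hκ.tendsto_relFreq p α β z).limUnder_eq

end IsPairDensity

/-- No pair at distance z exists, so `relFreq` vanishes for every radius. -/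
theorem pairCorr_eq_zero {w : ℤ → Letter} {α β : Letter} {z : ℝ}
    (hz : z ∉ controlPoints w β - controlPoints w α) : pairCorr w α β z = 0 := by
  have h : relFreq w α β z = fun _ => 0 := by
    funext r
    have : {x | x ∈ controlPoints w α ∩ Metric.ball 0 r ∧ x + z ∈ controlPoints w β} = ∅ := by
      rw [Set.eq_empty_iff_forall_notMem]
      rintro x ⟨hx, hxz⟩
      exact hz (Set.mem_sub.mpr ⟨x + z, hxz, x, hx.1, by ring⟩)
    rw [relFreq, this]
    simp
  rw [pairCorr, h]
  exact tendsto_const_nhds.limUnder_eq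

end SisterSilver

/-! ### The main theorem -/

open SisterSilver in
theorem mainTheorem2 :
    -- for each of the two words of the 2-cycle
    (∀ p : Fin 2,
      -- the pair correlations exist
      (∀ α β : Letter, ∀ z ∈ ringSqrtTwo,
        Tendsto (relFreq (biWord p) α β z) atTop (𝓝 (pairCorr (biWord p) α β z))) ∧
      -- and satisfy the exact renormalisation relations
      (∀ z ∈ ringSqrtTwo, RenormRelationsAt (pairCorr (biWord p)) z) ∧
      -- and the vanishing condition
      (∀ α β : Letter, ∀ z ∈ ringSqrtTwo,
        z ∉ controlPoints (biWord p) β - controlPoints (biWord p) α →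
          pairCorr (biWord p) α β z = 0)) ∧
    -- and they are the same for both words
    (∀ α β : Letter, ∀ z ∈ ringSqrtTwo,
      pairCorr (biWord 0) α β z = pairCorr (biWord 1) α β z) := by
  obtain ⟨κ, hκ⟩ := exists_isPairDensity
  refine ⟨fun p => ⟨fun α β z _ => ?_, fun z _ => ?_, fun α β z _ => pairCorr_eq_zero⟩,
    fun α β z _ => by rw [hκ.pairCorr_eq, hκ.pairCorr_eq]⟩
  · rw [hκ.pairCorr_eq]
    exact hκ.tendsto_relFreq p α β z
  · obtain ⟨h1, h2, h3, h4⟩ := hκ.renormRelationsAt z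
    -- The relations are linear and homogeneous, so they survive division by the density of control
    -- points.
    simp only [RenormRelationsAt, hκ.pairCorr_eq]
    refine ⟨?_, ?_, ?_, ?_⟩
    · rw [← mul_div_assoc, h1]; ring
    · rw [← mul_div_assoc, h2]; ring
    · rw [← mul_div_assoc, h3]; ring
    · rw [← mul_div_assoc, h4]; ring
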